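/- All graphs are finite and may have multiple edges and loops. A subgraph specified by a set of edges has as vertices exactly the ends of these edges. For a finite graph $H$, let $\kappa(H)$ be the number of spanning forests of $H$, i.e. of inclusion-maximal acyclic edge sets (one spanning tree in each connected component of $H$; $\kappa=1$ for the empty graph). A graph with reflective symmetry is a finite graph $G=(V,E)$ with a non-degenerate drawing in $\mathbf{R}^2$ (distinct vertices are distinct points, each edge is a simple curve joining its ends, closed if the edge is a loop, and containing no vertex other than its ends, and distinct edges are distinct curves; edges may cross each other) such that reflection about the vertical line $\ell=\{x=0\}$ takes the drawing to itself, every edge fixed by this reflection is fixed pointwise, and no edge crosses $\ell$ (each edge lies in one of the two closed half-planes bounded by $\ell$). Let $\phi$ be the induced involution on $V$ and $E$, with fixed sets $V^\phi$ and $E^\phi$, and let $E=E_L\sqcup E^\phi\sqcup E_R$, where $E_L$ and $E_R$ are the non-fixed edges on the left and on the right of $\ell$. Let $G_+$ be the graph obtained from the subgraph $E_L\cup E^\phi$ by subdividing each edge in $E^\phi$ once, and $G_-$ the graph obtained from the subgraph $E_R$ by identifying its vertices in $V^\phi$ to a single vertex. Corollary. Let $G$ be a graph with reflective symmetry such that $V^\phi\neq\emptyset$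 and every vertex in $V^\phi$ is an end of some edge of $G$. If $G_+$ is connected, then $$\kappa(G)=2^{|V^\phi|-|E^\phi|-1}\,\kappa(G_+)\,\kappa(G_-).$$ -/

import Mathlib

namespace Graph

section Basics

variable {α β : Type*}

/-- A (multi)graph is connected if it has a vertex and any two of its vertices are joined by
a walk. -/
def IsConnected (G : Graph α β) : Prop :=
  V(G).Nonempty ∧ ∀ x ∈ V(G), ∀ y ∈ V(G), Relation.ReflTransGen G.Adj x y

/-- A set `F` of edges of `G` is a forest if it contains no cycle: no edge of `F` has its two ends
joined by a walk through the other edges of `F`. (A loop has equal ends, which are joined by the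
walk of length zero; so a forest has no loops.) -/
def IsForestSet (G : Graph α β) (F : Set β) : Prop :=
  F ⊆ E(G) ∧ ∀ e ∈ F, ∀ x y, G.IsLink e x y →
    ¬ Relation.ReflTransGen (G.restrict (F \ {e})).Adj x y

/-- The number `κ(G)` of spanning forests of a finite graph `G`, that is, of inclusion-maximal
forests of `G`: one spanning tree in every connected component. -/
noncomputable def numSpanningForests (G : Graph α β) : ℕ :=
  {F : Set β | Maximal G.IsForestSet F}.ncard

/-- The subgraph of `G` specified by a set `F` of edges: its vertices are the ends of the
edges in `F`. -/
def edgeSubgraph (G : Graph α β) (F : Set β) : Graph α β where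
  vertexSet := {v | ∃ e ∈ F, G.Inc e v}
  IsLink e x y := e ∈ F ∧ G.IsLink e x y
  isLink_symm := fun _ _ => ⟨fun _ _ h => ⟨h.1, h.2.symm⟩⟩
  eq_or_eq_of_isLink_of_isLink := fun _ _ _ _ _ h h' => h.2.left_eq_or_eq h'.2
  left_mem_of_isLink := fun e _ y h => ⟨e, h.1, y, h.2⟩

/-- The graph obtained from `G` by subdividing every edge in `S` once.

A vertex is a vertex `v` of `G` (as `Sum.inl v`) or the new vertex `Sum.inr e` in the middle of an
edge `e ∈ S`. An edge `e ∉ S` of `G` is kept (as `Sum.inl e`). An edge `e ∈ S` is replaced by its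
two halves, each joining an end `x` of `e` to the new vertex `Sum.inr e`: if `e` has distinct ends
`x` and `y`, the halves are `(e, x, false)` and `(e, y, false)`; if `e` is a loop at `x`, they are
`(e, x, false)` and `(e, x, true)`. -/
def subdivide (G : Graph α β) (S : Set β) : Graph (α ⊕ β) (β ⊕ (β × α × Bool)) where
  vertexSet := Sum.inl '' V(G) ∪ Sum.inr '' (S ∩ E(G))
  IsLink
    | .inl e, a, b => e ∉ S ∧ ∃ x y, G.IsLink e x y ∧ a = .inl x ∧ b = .inl y
    | .inr (e, x, false), a, b =>
        e ∈ S ∧ G.Inc e x ∧ ((a = .inl x ∧ b = .inr e) ∨ (a = .inr e ∧ b = .inl x))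
    | .inr (e, x, true), a, b =>
        e ∈ S ∧ G.IsLoopAt e x ∧ ((a = .inl x ∧ b = .inr e) ∨ (a = .inr e ∧ b = .inl x))
  isLink_symm := by
    rintro (e | ⟨e, x, _ | _⟩) -
    · exact ⟨fun a b ⟨h, x, y, hxy, ha, hb⟩ => ⟨h, y, x, hxy.symm, hb, ha⟩⟩
    · exact ⟨fun a b ⟨h, hx, hab⟩ => ⟨h, hx, by tauto⟩⟩
    · exact ⟨fun a b ⟨h, hx, hab⟩ => ⟨h, hx, by tauto⟩⟩
  eq_or_eq_of_isLink_of_isLink := by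
    rintro (e | ⟨e, x, _ | _⟩) a b c d h h'
    · obtain ⟨-, x, y, hxy, rfl, rfl⟩ := h
      obtain ⟨-, z, w, hzw, rfl, rfl⟩ := h'
      rcases hxy.left_eq_or_eq hzw with rfl | rfl <;> simp
    · obtain ⟨-, -, h⟩ := h
      obtain ⟨-, -, h'⟩ := h'
      rcases h with ⟨rfl, rfl⟩ | ⟨rfl, rfl⟩ <;> rcases h' with ⟨rfl, rfl⟩ | ⟨rfl, rfl⟩ <;> simp
    · obtain ⟨-, -, h⟩ := h
      obtain ⟨-, -, h'⟩ := h'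
      rcases h with ⟨rfl, rfl⟩ | ⟨rfl, rfl⟩ <;> rcases h' with ⟨rfl, rfl⟩ | ⟨rfl, rfl⟩ <;> simp
  left_mem_of_isLink := by
    rintro (e | ⟨e, x, _ | _⟩) a b h
    · obtain ⟨-, x, y, hxy, rfl, rfl⟩ := h
      exact Or.inl ⟨x, hxy.left_mem, rfl⟩
    · obtain ⟨he, hx, ⟨rfl, rfl⟩ | ⟨rfl, rfl⟩⟩ := h
      · exact Or.inl ⟨x, hx.vertex_mem, rfl⟩
      · exact Or.inr ⟨e, ⟨he, hx.edge_mem⟩, rfl⟩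
    · obtain ⟨he, hx, ⟨rfl, rfl⟩ | ⟨rfl, rfl⟩⟩ := h
      · exact Or.inl ⟨x, hx.vertex_mem, rfl⟩
      · exact Or.inr ⟨e, ⟨he, hx.edge_mem⟩, rfl⟩

open Classical in
/-- The map that identifies all elements of `X` to the single new point `none`. -/
noncomputable def collapse (X : Set α) (v : α) : Option α :=
  if v ∈ X then none else some v

/-- The graph obtained from `G` by identifying all of its vertices that lie in `X` to a single
vertex; all edges are kept. -/
noncomputable def identify (G : Graph α β) (X : Set α) : Graph (Option α) β :=
  G.map (collapse X)

/-- A non-degenerate drawing of a graph in the plane, edges being allowed to cross each other: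
vertices are distinct points; an edge is a simple curve joining its ends (a simple closed curve if
it is a loop) which meets no vertex except at its ends; distinct edges are distinct curves.
The values of `pos` and `curve` outside `V(G)` and `E(G)` are irrelevant. -/
structure Drawing (G : Graph α β) where
  /-- the position of a vertex -/
  pos : α → ℝ × ℝ
  /-- a parametrization of the curve that represents an edge -/
  curve : β → C(unitInterval, ℝ × ℝ)
  pos_injOn : Set.InjOn pos V(G)
  curve_ends : ∀ e ∈ E(G), ∃ x y, G.IsLink e x y ∧ curve e 0 = pos x ∧ curve e 1 = pos y
  curve_simple : ∀ e ∈ E(G), ∀ s t, curve e s = curve e t →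
    s = t ∨ (s = 0 ∧ t = 1) ∨ (s = 1 ∧ t = 0)
  curve_interior : ∀ e ∈ E(G), ∀ t, t ≠ 0 → t ≠ 1 → ∀ v ∈ V(G), curve e t ≠ pos v
  range_injOn : Set.InjOn (fun e => Set.range (curve e)) E(G)

/-- Reflection of the plane about the vertical axis `ℓ = {(x, y) | x = 0}`. -/
def reflectPlane (p : ℝ × ℝ) : ℝ × ℝ := (-p.1, p.2)

namespace Drawing

variable {G : Graph α β} (D : G.Drawing)

/-- The point set of an edge in the drawing. -/
def trace (e : β) : Set (ℝ × ℝ) := Set.range (D.curve e)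

/-- `V^φ`: the vertices that the reflection maps to themselves. -/
def fixedVertices : Set α := {v ∈ V(G) | reflectPlane (D.pos v) = D.pos v}

/-- `E^φ`: the edges that the reflection maps to themselves. -/
def fixedEdges : Set β := {e ∈ E(G) | reflectPlane '' D.trace e = D.trace e}

/-- `E_L`: the edges on the left side of the axis. -/
def leftEdges : Set β := {e ∈ E(G) | e ∉ D.fixedEdges ∧ ∀ p ∈ D.trace e, p.1 ≤ 0}

/-- `E_R`: the edges on the right side of the axis. -/
def rightEdges : Set β := {e ∈ E(G) | e ∉ D.fixedEdges ∧ ∀ p ∈ D.trace e, 0 ≤ p.1}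

/-- The drawing makes `G` a graph with reflective symmetry: reflection about the axis takes the
drawing to itself, every edge that is fixed by the reflection is fixed pointwise, and no edge
crosses the axis. -/
structure IsReflective : Prop where
  vertex_reflect : ∀ v ∈ V(G), ∃ w ∈ V(G), D.pos w = reflectPlane (D.pos v)
  edge_reflect : ∀ e ∈ E(G), ∃ f ∈ E(G), D.trace f = reflectPlane '' D.trace e
  fixed_pointwise : ∀ e ∈ D.fixedEdges, ∀ p ∈ D.trace e, reflectPlane p = p
  not_crossing : ∀ e ∈ E(G), (∀ p ∈ D.trace e, p.1 ≤ 0) ∨ (∀ p ∈ D.trace e, 0 ≤ p.1)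

/-- `G_+`: the subgraph with edge set `E_L ∪ E^φ`, with every edge in `E^φ` subdivided. -/
def plusGraph : Graph (α ⊕ β) (β ⊕ (β × α × Bool)) :=
  (G.edgeSubgraph (D.leftEdges ∪ D.fixedEdges)).subdivide D.fixedEdges

/-- `G_-`: the subgraph with edge set `E_R`, with its vertices in `V^φ` identified to a single
vertex. -/
noncomputable def minusGraph : Graph (Option α) β :=
  (G.edgeSubgraph D.rightEdges).identify D.fixedVertices

end Drawing

end Basics

end Graph

/-! Choose a root `r` on the axis. By the matrix-tree theorem each of the three counts is the
determinant of a Laplacian with the row and column of the root deleted. Let `A` be the left vertices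
that are ends of left edges, and `B` the axis vertices other than `r`. The reduced Laplacian of `G`
is then indexed by `A`, `B` and a mirror copy of `A`.

Reflection splits this matrix (`det_fromBlocks_reflect`). Functions antisymmetric under reflection
vanish on the axis and see the left half with the axis contracted to the root, which is the mirror
image of `G_-`. Symmetric functions see the left half with its axis rows doubled. Taking out these
factors gives `2 ^ |B|`, where `|B| = |V^φ| - 1`, and leaves every axis edge with weight `1/2`.

An edge of weight `1/2` is two unit edges in series. Hence eliminating the midpoints from the
Laplacian of `G_+` (`det_fromBlocks_half`) leaves the same matrix, at the price of one factor `2`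
for each edge in `E^φ`. `det_symEnd` combines these facts.

The rest is translation: `Presents.numSpanningForests_eq_det` is the matrix-tree theorem for graphs
given by end maps, and all three graphs are presented by the same end maps of the left and axis
edges. Connectedness of `G_+` makes every presented vertex reachable from the root in each graph.
Isolated vertices off the axis are left out, as they do not affect forests. -/

section SpanningForests

open Matrix Relation

/-! ### Cauchy–Binet -/

section CauchyBinet

variable {ε I R : Type*} [Fintype ε] [Fintype I] [DecidableEq I] [CommRing R]

/-- A form of the Cauchy–Binet formula: the Gram determinant as a sum over all families of rows. -/
theorem sum_det_submatrix_sq (C : Matrix ε I R) :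
    ∑ f : I → ε, (C.submatrix f id).det ^ 2 = (Fintype.card I).factorial * (Cᵀ * C).det := by
  have expand (f : I → ε) : (C.submatrix f id).det =
      ∑ σ : Equiv.Perm I, ((σ.sign : ℤ) : R) * ∏ i, C (f i) (σ i) := by
    rw [← det_transpose, det_apply']
    rfl
  have gram (σ : Equiv.Perm I) : ((Cᵀ * C).submatrix σ id).det =
      ∑ τ : Equiv.Perm I, ((τ.sign : ℤ) : R) * ∑ f : I → ε, ∏ i, (C (f i) (σ i) * C (f i) (τ i)) := by
    rw [← det_transpose, det_apply']
    refine Finset.sum_congr rfl fun τ _ => ?_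
    congr 1
    exact (Finset.prod_univ_sum (fun _ => Finset.univ)
      (fun i e => C e (σ i) * C e (τ i))).trans (by rw [Fintype.piFinset_univ])
  -- Expand both factors of the square. For fixed `σ`, the sums over `τ` and `f` assemble the Gram
  -- determinant with rows permuted by `σ`, whose sign cancels that of `σ`. Each of the `(card I)!`
  -- permutations thus contributes equally.
  calc ∑ f : I → ε, (C.submatrix f id).det ^ 2
      = ∑ σ : Equiv.Perm I, ((σ.sign : ℤ) : R) * ((Cᵀ * C).submatrix σ id).det := by
        simp_rw [gram, Finset.mul_sum, sq, expand, Finset.sum_mul_sum]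
        rw [Finset.sum_comm]
        refine Finset.sum_congr rfl fun σ _ => ?_
        rw [Finset.sum_comm]
        refine Finset.sum_congr rfl fun τ _ => Finset.sum_congr rfl fun f _ => ?_
        rw [Finset.prod_mul_distrib]
        ring
    _ = ∑ σ : Equiv.Perm I, (Cᵀ * C).det := by
        refine Finset.sum_congr rfl fun σ _ => ?_
        rw [det_permute, ← mul_assoc, ← Int.cast_mul, ← Units.val_mul, Int.units_mul_self]
        simp
    _ = _ := by simp [Fintype.card_perm]

end CauchyBinet

/-! ### Incidence vectors: spans, walks and unimodularity -/

section Incidence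

variable {ε I : Type*} [DecidableEq I]

/-- The coordinate vector of a vertex: a standard basis vector, or `0` for the root `none`. -/
def vertexVec (R : Type*) [Ring R] (a : Option I) (i : I) : R := if a = some i then 1 else 0

/-- The vector of the edge `e` that joins `s e` to `t e`. -/
def incVec (R : Type*) [Ring R] (s t : ε → Option I) (e : ε) : I → R :=
  vertexVec R (s e) - vertexVec R (t e)

/-- The incidence matrix of the multigraph on `Option I` whose edge `e` joins `s e` to `t e`, with
the column of the root `none` deleted. -/
def incMat (R : Type*) [Ring R] (s t : ε → Option I) : Matrix ε I R :=
  of (incVec R s t)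

/-- Adjacency through an edge in `F`, where the edge `e` joins `s e` and `t e`. -/
def EdgeRel {V : Type*} (s t : ε → V) (F : Set ε) (a b : V) : Prop :=
  ∃ e ∈ F, (s e = a ∧ t e = b) ∨ (s e = b ∧ t e = a)

theorem EdgeRel.symm {V : Type*} {s t : ε → V} {F : Set ε} {a b : V} (h : EdgeRel s t F a b) :
    EdgeRel s t F b a := by
  obtain ⟨e, he, h⟩ := h
  exact ⟨e, he, h.symm⟩

/-- The incidence vectors telescope along a walk. -/
theorem vertexVec_sub_mem_span {R : Type*} [Ring R] {s t : ε → Option I} {F : Set ε}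
    {a b : Option I} (h : ReflTransGen (EdgeRel s t F) a b) :
    vertexVec R a - vertexVec R b ∈ Submodule.span R (incVec R s t '' F) := by
  induction h with
  | refl => simp
  | tail _ h ih =>
    obtain ⟨e, he, h⟩ := h
    have key : incVec R s t e ∈ Submodule.span R (incVec R s t '' F) :=
      Submodule.subset_span ⟨e, he, rfl⟩
    have hval : incVec R s t e = vertexVec R (s e) - vertexVec R (t e) := rfl
    rw [hval] at key
    rcases h with ⟨rfl, rfl⟩ | ⟨rfl, rfl⟩
    · simpa using add_mem ih key
    · simpa using sub_mem ih key

theorem vertexVec_dotProduct {R : Type*} [CommRing R] [Fintype I] (f : Option I → R)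
    (a : Option I) :
    vertexVec R a ⬝ᵥ (fun i => f (some i) - f none) = f a - f none := by
  cases a with
  | none => simp [vertexVec, dotProduct]
  | some j => simp [vertexVec, dotProduct, ite_mul]

open Classical in
/-- The potential that is `1` on the vertices reachable from `a`, shifted to vanish at the root. -/
noncomputable def reachPotential (R : Type*) [CommRing R] (s t : ε → Option I) (F : Set ε)
    (a : Option I) (b : Option I) : R :=
  if ReflTransGen (EdgeRel s t F) a b then 1 else 0

omit [DecidableEq I] in
theorem reachPotential_eq {R : Type*} [CommRing R] {s t : ε → Option I} {F : Set ε}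
    (a : Option I) {e : ε} (he : e ∈ F) :
    reachPotential R s t F a (s e) = reachPotential R s t F a (t e) := by
  have h : ReflTransGen (EdgeRel s t F) a (s e) ↔ ReflTransGen (EdgeRel s t F) a (t e) :=
    ⟨fun h => h.tail ⟨e, he, .inl ⟨rfl, rfl⟩⟩, fun h => h.tail ⟨e, he, .inr ⟨rfl, rfl⟩⟩⟩
  unfold reachPotential
  split_ifs <;> tauto

theorem incVec_dotProduct {R : Type*} [CommRing R] [Fintype I] (s t : ε → Option I)
    (f : Option I → R) (e : ε) :
    incVec R s t e ⬝ᵥ (fun i => f (some i) - f none) = f (s e) - f (t e) := by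
  change (vertexVec R (s e) - vertexVec R (t e)) ⬝ᵥ _ = _
  rw [sub_dotProduct, vertexVec_dotProduct, vertexVec_dotProduct]
  ring

/-- If `b` is not reachable from `a`, the indicator of the component of `a` pairs to zero with every
edge of `F`, but to `1` with the difference. This is what turns acyclicity into linear independence.
-/
theorem vertexVec_sub_mem_span_iff {R : Type*} [CommRing R] [Nontrivial R] [Fintype I]
    {s t : ε → Option I} {F : Set ε} {a b : Option I} :
    vertexVec R a - vertexVec R b ∈ Submodule.span R (incVec R s t '' F) ↔
      ReflTransGen (EdgeRel s t F) a b := by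
  refine ⟨fun h => ?_, vertexVec_sub_mem_span⟩
  by_contra hab
  set f := reachPotential R s t F a
  have hspan : ∀ w ∈ Submodule.span R (incVec R s t '' F),
      w ⬝ᵥ (fun i => f (some i) - f none) = 0 := by
    intro w hw
    induction hw using Submodule.span_induction with
    | mem x hx =>
      obtain ⟨e, he, rfl⟩ := hx
      rw [incVec_dotProduct, sub_eq_zero]
      exact reachPotential_eq a he
    | zero => simp
    | add x y _ _ hx hy => rw [add_dotProduct, hx, hy, add_zero]
    | smul c x _ hx => rw [smul_dotProduct, hx, smul_zero]
  have := hspan _ h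
  rw [sub_dotProduct, vertexVec_dotProduct, vertexVec_dotProduct] at this
  have ha : f a = 1 := if_pos .refl
  have hb : f b = 0 := if_neg hab
  simp [ha, hb] at this

theorem vertexVec_some {R : Type*} [Ring R] (i : I) :
    (vertexVec R (some i) : I → R) = Pi.single i 1 := by
  ext j
  simp [vertexVec, Pi.single_apply, eq_comm]

theorem vertexVec_none {R : Type*} [Ring R] : (vertexVec R (none : Option I) : I → R) = 0 := by
  ext j
  simp [vertexVec]

theorem span_incVec_eq_top {R : Type*} [Ring R] [Finite I] {s t : ε → Option I} {F : Set ε}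
    (h : ∀ i, ReflTransGen (EdgeRel s t F) (some i) none) :
    Submodule.span R (incVec R s t '' F) = ⊤ := by
  rw [eq_top_iff, ← (Pi.basisFun R I).span_eq, Submodule.span_le]
  rintro _ ⟨i, rfl⟩
  have := vertexVec_sub_mem_span (R := R) (h i)
  rwa [vertexVec_some, vertexVec_none, sub_zero, ← Pi.basisFun_apply] at this

/-- A vertex cut off from the root would give a kernel vector, namely the potential of its
component. So all vertices reach the root, the rows span over `ℤ`, and the matrix is invertible over
`ℤ`. -/
theorem isUnit_det_incMat_int [Fintype I] {s t : I → Option I} (h : (incMat ℤ s t).det ≠ 0) :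
    IsUnit (incMat ℤ s t).det := by
  have hconn : ∀ i, ReflTransGen (EdgeRel s t Set.univ) (some i) none := by
    intro i
    by_contra hi
    refine h (exists_mulVec_eq_zero_iff.1 ?_)
    set f := reachPotential ℤ s t Set.univ (some i)
    refine ⟨fun j => f (some j) - f none, fun h0 => ?_, ?_⟩
    · have ha : f (some i) = 1 := if_pos .refl
      have hb : f none = 0 := if_neg hi
      simpa [ha, hb] using congrFun h0 i
    · ext e
      exact (incVec_dotProduct s t f e).trans
        (sub_eq_zero.2 (reachPotential_eq (some i) (Set.mem_univ e)))
  have hspan := span_incVec_eq_top (R := ℤ) hconn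
  rw [← isUnit_iff_isUnit_det, ← vecMul_surjective_iff_isUnit]
  have hr : LinearMap.range (incMat ℤ s t).vecMulLinear = ⊤ := by
    rw [range_vecMulLinear, ← hspan, Set.image_univ]
    rfl
  exact LinearMap.range_eq_top.1 hr

theorem det_incMat_sq [Fintype I] {s t : I → Option I} (h : (incMat ℚ s t).det ≠ 0) :
    (incMat ℚ s t).det ^ 2 = 1 := by
  have hcast : (incMat ℚ s t).det = ((incMat ℤ s t).det : ℚ) := by
    rw [← eq_intCast (Int.castRingHom ℚ), RingHom.map_det]
    congr 1
    ext e i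
    simp [incMat, incVec, vertexVec]
  rw [hcast] at h ⊢
  have := isUnit_det_incMat_int (s := s) (t := t) (by exact_mod_cast h)
  rcases Int.isUnit_iff.1 this with h | h <;> simp [h]

theorem det_submatrix_incMat_sq [Fintype I] (s t : ε → Option I) (f : I → ε) [Decidable
    (LinearIndependent ℚ (fun i => incVec ℚ s t (f i)))] :
    ((incMat ℚ s t).submatrix f id).det ^ 2 =
      if LinearIndependent ℚ (fun i => incVec ℚ s t (f i)) then 1 else 0 := by
  have hiff : LinearIndependent ℚ (fun i => incVec ℚ s t (f i)) ↔
      ((incMat ℚ s t).submatrix f id).det ≠ 0 := by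
    rw [← isUnit_iff_ne_zero, ← isUnit_iff_isUnit_det, ← linearIndependent_rows_iff_isUnit]
    rfl
  split_ifs with h
  · exact det_incMat_sq (s := s ∘ f) (t := t ∘ f) (hiff.1 h)
  · rw [hiff, not_not] at h
    rw [h]
    simp

end Incidence

/-! ### Counting bases by determinants -/

section Bases

variable {ε I K : Type*} [Fintype ε] [Fintype I] [DecidableEq I] [Field K]

/-- Each independent set of `card I` indices is the range of `(card I)!` independent families. -/
theorem card_linearIndependent_families (c : ε → I → K) :
    Nat.card {f : I → ε // LinearIndependent K (fun i => c (f i))} =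
      (Fintype.card I).factorial *
        {F : Set ε | LinearIndepOn K c F ∧ F.ncard = Fintype.card I}.ncard := by
  classical
  set B := {F : Set ε | LinearIndepOn K c F ∧ F.ncard = Fintype.card I}
  have hinj (f : {f : I → ε // LinearIndependent K (fun i => c (f i))}) :
      Function.Injective f.1 := fun i j hij => f.2.injective (by simp only [hij])
  have hrange {F : Set ε} (g : I ≃ F) : Set.range (fun i => (g i : ε)) = F := by
    ext x
    exact ⟨fun ⟨i, hi⟩ => hi ▸ (g i).2, fun hx => ⟨g.symm ⟨x, hx⟩, by simp⟩⟩
  -- An independent family is injective, so it amounts to its range together with a bijection from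
  -- `I` onto it.
  let e : (Σ F : B, I ≃ F.1) → {f : I → ε // LinearIndependent K (fun i => c (f i))} :=
    fun p => ⟨fun i => (p.2 i : ε), p.1.2.1.linearIndependent.comp _ p.2.injective⟩
  have he : e.Bijective := by
    constructor
    · rintro ⟨⟨F, hF⟩, g⟩ ⟨⟨F', hF'⟩, g'⟩ h
      have h' : (fun i => (g i : ε)) = fun i => (g' i : ε) := congrArg Subtype.val h
      obtain rfl : F = F' := 
        (hrange g).symm.trans ((congrArg Set.range h').trans (hrange g'))
      congr 1
      ext i
      exact congrFun h' i
    · intro f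
      refine ⟨⟨⟨Set.range f.1, ?_⟩, Equiv.ofInjective _ (hinj f)⟩, rfl⟩
      refine ⟨(linearIndependent_equiv (Equiv.ofInjective _ (hinj f))).1 f.2, ?_⟩
      rw [← Set.image_univ, Set.ncard_image_of_injective _ (hinj f), Set.ncard_univ,
        Nat.card_eq_fintype_card]
  rw [← Nat.card_congr (Equiv.ofBijective e he), Nat.card_sigma]
  have : ∀ F : B, Nat.card (I ≃ F.1) = (Fintype.card I).factorial := by
    intro F
    rw [Nat.card_eq_fintype_card, Fintype.card_equiv]
    refine Fintype.equivOfCardEq ?_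
    rw [← F.2.2, ← Nat.card_coe_set_eq, Nat.card_eq_fintype_card]
  simp_rw [this]
  rw [Finset.sum_const, Finset.card_univ, smul_eq_mul, mul_comm, ← Nat.card_coe_set_eq,
    Nat.card_eq_fintype_card]

omit [DecidableEq I] in
theorem maximal_linearIndepOn_iff {c : ε → I → K} (hc : Submodule.span K (Set.range c) = ⊤)
    (F : Set ε) :
    Maximal (LinearIndepOn K c) F ↔ LinearIndepOn K c F ∧ F.ncard = Fintype.card I := by
  have hcard {F : Set ε} (hF : LinearIndepOn K c F) :
      F.ncard = Module.finrank K (Submodule.span K (c '' F)) := by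
    classical
    rw [← Nat.card_coe_set_eq, Nat.card_eq_fintype_card, Set.image_eq_range]
    exact (finrank_span_eq_card hF.linearIndependent).symm
  constructor
  · intro h
    refine ⟨h.prop, ?_⟩
    have hspan : Submodule.span K (c '' F) = ⊤ := by
      rw [eq_top_iff, ← hc, Submodule.span_le]
      rintro _ ⟨e, rfl⟩
      by_contra he
      have hmem := h.le_of_ge (h.prop.insert he) (Set.subset_insert e F) (Set.mem_insert e F)
      exact he (Submodule.subset_span ⟨e, hmem, rfl⟩)
    rw [hcard h.prop, hspan, finrank_top, Module.finrank_fintype_fun_eq_card]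
  · rintro ⟨h, hF⟩
    refine ⟨h, fun F' hF' hle => ?_⟩
    have h1 : F'.ncard ≤ F.ncard := by
      rw [hF, ← Module.finrank_fintype_fun_eq_card K, hcard hF']
      exact Submodule.finrank_le _
    exact (Set.eq_of_subset_of_ncard_le hle h1).ge

/-- The matrix-tree theorem for the reduced incidence matrix, in terms of linear independence. -/
theorem ncard_maximal_linearIndepOn_incMat {s t : ε → Option I}
    (h : ∀ i, ReflTransGen (EdgeRel s t Set.univ) (some i) none) :
    ({F : Set ε | Maximal (LinearIndepOn ℚ (incVec ℚ s t)) F}.ncard : ℚ) =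
      ((incMat ℚ s t)ᵀ * incMat ℚ s t).det := by
  classical
  have hspan := span_incVec_eq_top (R := ℚ) h
  rw [Set.image_univ] at hspan
  simp_rw [maximal_linearIndepOn_iff hspan]
  -- The squared minors are `0` or `1`, so Cauchy–Binet counts independent families; each basis is
  -- counted `(card I)!` times on both sides.
  have h1 := sum_det_submatrix_sq (incMat ℚ s t)
  have h2 := card_linearIndependent_families (incVec ℚ s t)
  simp_rw [det_submatrix_incMat_sq, Finset.sum_boole] at h1
  rw [Nat.card_eq_fintype_card, Fintype.card_subtype] at h2
  rw [h2, Nat.cast_mul] at h1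
  exact mul_left_cancel₀ (by positivity) h1

end Bases

namespace Graph

/-! ### The matrix-tree theorem for presented graphs -/

section MatrixTree

variable {α β ε V : Type*}

/-- `G` is the image of the multigraph on `V` whose edge `e` joins `s e` and `t e`, up to isolated
vertices. -/
structure Presents (G : Graph α β) (q : V → α) (g : ε → β) (s t : ε → V) : Prop where
  vertex_injective : q.Injective
  edge_injective : g.Injective
  edgeSet_subset : E(G) ⊆ Set.range g
  isLink : ∀ e, G.IsLink (g e) (q (s e)) (q (t e))

variable {G : Graph α β} {q : V → α} {g : ε → β} {s t : ε → V}

namespace Presents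

theorem edgeSet_eq (h : G.Presents q g s t) : E(G) = Set.range g := by
  refine h.edgeSet_subset.antisymm ?_
  rintro _ ⟨e, rfl⟩
  exact (h.isLink e).edge_mem

theorem adj_iff (h : G.Presents q g s t) {F : Set ε} {a : V} {y : α} :
    (G.restrict (g '' F)).Adj (q a) y ↔ ∃ b, q b = y ∧ EdgeRel s t F a b := by
  constructor
  · rintro ⟨_, ⟨e, he, rfl⟩, hl⟩
    rcases hl.eq_and_eq_or_eq_and_eq (h.isLink e) with ⟨h1, rfl⟩ | ⟨h1, rfl⟩
    · exact ⟨_, rfl, e, he, .inl ⟨(h.vertex_injective h1).symm, rfl⟩⟩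
    · exact ⟨_, rfl, e, he, .inr ⟨rfl, (h.vertex_injective h1).symm⟩⟩
  · rintro ⟨b, rfl, e, he, ⟨rfl, rfl⟩ | ⟨rfl, rfl⟩⟩
    · exact ⟨g e, ⟨e, he, rfl⟩, h.isLink e⟩
    · exact ⟨g e, ⟨e, he, rfl⟩, (h.isLink e).symm⟩

theorem reach_iff (h : G.Presents q g s t) {F : Set ε} {a b : V} :
    ReflTransGen (G.restrict (g '' F)).Adj (q a) (q b) ↔ ReflTransGen (EdgeRel s t F) a b := by
  constructor
  · intro hab
    -- A walk that starts in the range of `q` stays there, since all ends of edges lie in it.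
    have key : ∀ y, ReflTransGen (G.restrict (g '' F)).Adj (q a) y →
        ∃ c, q c = y ∧ ReflTransGen (EdgeRel s t F) a c := by
      intro y hy
      induction hy with
      | refl => exact ⟨a, rfl, .refl⟩
      | tail _ h' ih =>
        obtain ⟨c, rfl, hc⟩ := ih
        obtain ⟨d, rfl, hd⟩ := h.adj_iff.1 h'
        exact ⟨d, rfl, hc.tail hd⟩
    obtain ⟨c, hc, hac⟩ := key _ hab
    rwa [h.vertex_injective hc] at hac
  · exact fun hab => hab.lift q fun _ b hb => h.adj_iff.2 ⟨b, rfl, hb⟩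

theorem reach_univ_iff (h : G.Presents q g s t) {a b : V} :
    ReflTransGen G.Adj (q a) (q b) ↔ ReflTransGen (EdgeRel s t Set.univ) a b := by
  rw [← h.reach_iff, Set.image_univ, ← h.edgeSet_eq, restrict_self]

theorem isForestSet_image_iff (h : G.Presents q g s t) {F : Set ε} :
    G.IsForestSet (g '' F) ↔ ∀ e ∈ F, ¬ ReflTransGen (EdgeRel s t (F \ {e})) (s e) (t e) := by
  have hdiff (e : ε) : g '' F \ {g e} = g '' (F \ {e}) := by
    rw [Set.image_sdiff h.edge_injective, Set.image_singleton]
  constructor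
  · rintro ⟨-, hF⟩ e he
    have := hF (g e) ⟨e, he, rfl⟩ _ _ (h.isLink e)
    rwa [hdiff, h.reach_iff] at this
  · intro hF
    refine ⟨by rw [h.edgeSet_eq]; exact Set.image_subset_range _ _, ?_⟩
    rintro _ ⟨e, he, rfl⟩ x y hxy hr
    rw [hdiff] at hr
    refine hF e he ?_
    rcases hxy.eq_and_eq_or_eq_and_eq (h.isLink e) with ⟨rfl, rfl⟩ | ⟨rfl, rfl⟩
    · exact h.reach_iff.1 hr
    · have hsymm : Std.Symm (EdgeRel s t (F \ {e})) := ⟨fun _ _ => EdgeRel.symm⟩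
      exact Std.Symm.symm _ _ (h.reach_iff.1 hr)

theorem numSpanningForests_eq_det {I : Type*} [Fintype ε] [Fintype I] [DecidableEq I]
    {q : Option I → α} {s t : ε → Option I} (h : G.Presents q g s t)
    (hconn : ∀ i, ReflTransGen G.Adj (q (some i)) (q none)) :
    (G.numSpanningForests : ℚ) = ((incMat ℚ s t)ᵀ * incMat ℚ s t).det := by
  rw [← ncard_maximal_linearIndepOn_incMat fun i => h.reach_univ_iff.1 (hconn i)]
  have hforest (F : Set ε) : G.IsForestSet (g '' F) ↔ LinearIndepOn ℚ (incVec ℚ s t) F := by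
    rw [h.isForestSet_image_iff, linearIndepOn_iff_notMem_span]
    simp_rw [← vertexVec_sub_mem_span_iff (R := ℚ)]
    rfl
  have hsurj {F : Set β} (hF : G.IsForestSet F) : ∃ F', g '' F' = F :=
    Set.subset_range_iff_exists_image_eq.1 (h.edgeSet_eq ▸ hF.1)
  have himage : {F | Maximal G.IsForestSet F} =
      (g '' ·) '' {F | Maximal (LinearIndepOn ℚ (incVec ℚ s t)) F} := by
    ext F
    constructor
    · intro hF
      obtain ⟨F, rfl⟩ := hsurj hF.prop
      refine ⟨F, ⟨(hforest F).1 hF.prop, fun F' hF' hle => ?_⟩, rfl⟩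
      exact (Set.image_subset_image_iff h.edge_injective).1
        (hF.le_of_ge ((hforest F').2 hF') (Set.image_mono hle))
    · rintro ⟨F, hF, rfl⟩
      refine ⟨(hforest F).2 hF.prop, fun F' hF' hle => ?_⟩
      obtain ⟨F', rfl⟩ := hsurj hF'
      exact Set.image_mono (hF.le_of_ge ((hforest F').1 hF')
        ((Set.image_subset_image_iff h.edge_injective).1 hle))
  rw [numSpanningForests, himage,
    Set.ncard_image_of_injective _ (Set.image_injective.2 h.edge_injective)]

end Presents

end MatrixTree

end Graph

/-! ### Block determinants of the three Laplacians -/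

section Determinants

variable {A B L Φ : Type*} [Fintype A] [Fintype B] [Fintype L] [Fintype Φ]
  [DecidableEq A] [DecidableEq B] [DecidableEq L] [DecidableEq Φ]

/-- Subtract the left rows from the right rows, then add the right columns to the left columns. The
result is block triangular, and its axis rows carry the factor `2`. -/
theorem det_fromBlocks_reflect {R : Type*} [CommRing R] (M : Matrix A A R) (N : Matrix A B R)
    (N' : Matrix B A R) (H : Matrix B B R) :
    (fromBlocks (fromBlocks M N N' ((2 : R) • H)) (fromRows 0 N') (fromCols 0 N) M).det =
      2 ^ Fintype.card B * (fromBlocks M N N' H).det * M.det := by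
  have hfactor : fromBlocks (1 : Matrix (A ⊕ B) (A ⊕ B) R) 0 (fromCols (-1) 0) 1 *
      fromBlocks (fromBlocks M N N' ((2 : R) • H)) (fromRows 0 N') (fromCols 0 N) M *
      fromBlocks 1 0 (fromCols 1 0) 1 =
      fromBlocks (fromBlocks 1 0 0 ((2 : R) • 1) * fromBlocks M N N' H) (fromRows 0 N') 0 M := by
    simp only [fromBlocks_multiply]
    congr 1
    · ext (i | i) (j | j) <;> simp [two_mul]
    · simp
    · ext i (j | j) <;> simp [mul_apply, Fintype.sum_sum_type, one_apply]
    · ext i j; simp [mul_apply, Fintype.sum_sum_type, one_apply]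
  have := congrArg det hfactor
  rw [det_mul, det_mul, det_fromBlocks_zero₁₂, det_fromBlocks_zero₁₂, det_fromBlocks_zero₂₁,
    det_mul, det_fromBlocks_zero₁₂] at this
  simpa using this

/-- Schur complement of the midpoint block, which is `2 • 1` because midpoints have degree two and
are pairwise nonadjacent. -/
theorem det_fromBlocks_half {K : Type*} [Field K] [NeZero (2 : K)] (M : Matrix A A K)
    (N : Matrix A B K) (N' : Matrix B A K) (H : Matrix B B K) (Z : Matrix Φ B K) :
    (fromBlocks (fromBlocks M N N' H) (fromRows 0 (-Zᵀ)) (fromCols 0 (-Z))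
      ((2 : K) • (1 : Matrix Φ Φ K))).det =
      2 ^ Fintype.card Φ * (fromBlocks M N N' (H - (2⁻¹ : K) • (Zᵀ * Z))).det := by
  have h2 : (2 : K) ≠ 0 := NeZero.ne 2
  have hfactor : fromBlocks (fromBlocks M N N' H) (fromRows 0 (-Zᵀ)) (fromCols 0 (-Z))
      ((2 : K) • (1 : Matrix Φ Φ K)) *
      fromBlocks 1 0 (fromCols 0 ((2⁻¹ : K) • Z)) 1 =
      fromBlocks (fromBlocks M N N' (H - (2⁻¹ : K) • (Zᵀ * Z))) (fromRows 0 (-Zᵀ)) 0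
        ((2 : K) • (1 : Matrix Φ Φ K)) := by
    simp only [fromBlocks_multiply]
    congr 1
    · ext (i | i) (j | j) <;>
        simp [sub_eq_add_neg]
    · simp
    · ext i (j | j)
      · simp
      · simp [h2]
    · simp
  have := congrArg det hfactor
  rw [det_mul, det_fromBlocks_zero₁₂, det_fromBlocks_zero₂₁] at this
  simpa [mul_comm] using this

/-- The coordinates of a vertex of the left half in the symmetric graph. -/
def leftCoord : A ⊕ B → (A ⊕ B) ⊕ A := Sum.inl

/-- The coordinates of the mirror image of a vertex of the left half. -/
def rightCoord : A ⊕ B → (A ⊕ B) ⊕ A := Sum.elim Sum.inr (Sum.inl ∘ Sum.inr)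

/-- The ends of the edges of the symmetric graph: the left edges, their mirror images, and the
edges on the axis. -/
def symEnd (s : L → Option (A ⊕ B)) (x : Φ → Option B) : (L ⊕ L) ⊕ Φ → Option ((A ⊕ B) ⊕ A) :=
  Sum.elim (Sum.elim (fun e => (s e).map leftCoord) fun e => (s e).map rightCoord)
    fun e => (x e).map (Sum.inl ∘ Sum.inr)

/-- The ends in the left half of the left edges and of the two halves of the edges on the axis. -/
def plusEnd (s : L → Option (A ⊕ B)) (x y : Φ → Option B) :
    L ⊕ (Φ ⊕ Φ) → Option ((A ⊕ B) ⊕ Φ) :=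
  Sum.elim (fun e => (s e).map Sum.inl)
    (Sum.elim (fun e => (x e).map (Sum.inl ∘ Sum.inr)) fun e => (y e).map (Sum.inl ∘ Sum.inr))

/-- The other ends of the edges in `plusEnd`. -/
def plusEnd' (t : L → Option (A ⊕ B)) : L ⊕ (Φ ⊕ Φ) → Option ((A ⊕ B) ⊕ Φ) :=
  Sum.elim (fun e => (t e).map Sum.inl)
    (Sum.elim (fun e => some (Sum.inr e)) fun e => some (Sum.inr e))

/-- The ends of the left edges after contraction of the axis. -/
def minusEnd (s : L → Option (A ⊕ B)) (e : L) : Option A :=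
  (s e).bind (Sum.elim some fun _ => none)

-- Purely algebraic: the end maps are arbitrary, and connectedness plays no role. `P₁` and `P₂` are
-- the columns of the left edges at `A` and `B`; a mirrored edge uses the same entries with `P₁`
-- moved to the mirror copy of `A`.
omit [DecidableEq L] in
theorem det_symEnd (s t : L → Option (A ⊕ B)) (x y : Φ → Option B) :
    2 ^ Fintype.card Φ *
      ((incMat ℚ (symEnd s x) (symEnd t y))ᵀ * incMat ℚ (symEnd s x) (symEnd t y)).det =
    2 ^ Fintype.card B *
      ((incMat ℚ (plusEnd s x y) (plusEnd' t))ᵀ * incMat ℚ (plusEnd s x y) (plusEnd' t)).det *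
      ((incMat ℚ (minusEnd s) (minusEnd t))ᵀ * incMat ℚ (minusEnd s) (minusEnd t)).det := by
  set P₁ : Matrix L A ℚ := (incMat ℚ s t).toCols₁
  set P₂ : Matrix L B ℚ := (incMat ℚ s t).toCols₂
  set X : Matrix Φ B ℚ := of fun e => vertexVec ℚ (x e)
  set Y : Matrix Φ B ℚ := of fun e => vertexVec ℚ (y e)
  have hminus : incMat ℚ (minusEnd s) (minusEnd t) = P₁ := by
    have key (a : Option (A ⊕ B)) (i : A) :
        vertexVec ℚ (a.bind (Sum.elim some fun _ => none)) i = vertexVec ℚ a (Sum.inl i) := by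
      rcases a with _ | _ | _ <;> simp [vertexVec]
    ext e i
    simp [incMat, incVec, minusEnd, key, P₁]
  have hplus : incMat ℚ (plusEnd s x y) (plusEnd' t) =
      fromBlocks (fromCols P₁ P₂) 0 (fromRows (fromCols 0 X) (fromCols 0 Y))
        (fromRows (-1) (-1)) := by
    ext (e | e | e) ((i | i) | i) <;>
      simp [incMat, incVec, plusEnd, plusEnd', P₁, P₂, X, Y, vertexVec, one_apply, eq_comm]
  have hsym : incMat ℚ (symEnd s x) (symEnd t y) =
      fromBlocks (fromRows (fromCols P₁ P₂) (fromCols 0 P₂)) (fromRows 0 P₁)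
        (fromCols 0 (X - Y)) 0 := by
    ext ((e | e) | e) ((i | i) | i) <;>
      simp [incMat, incVec, symEnd, P₁, P₂, X, Y, vertexVec, leftCoord, rightCoord]
  have hgram : (incMat ℚ (symEnd s x) (symEnd t y))ᵀ * incMat ℚ (symEnd s x) (symEnd t y) =
      fromBlocks (fromBlocks (P₁ᵀ * P₁) (P₁ᵀ * P₂) (P₂ᵀ * P₁) ((2 : ℚ) •
        (P₂ᵀ * P₂ + (2⁻¹ : ℚ) • ((X - Y)ᵀ * (X - Y))))) (fromRows 0 (P₂ᵀ * P₁))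
        (fromCols 0 (P₁ᵀ * P₂)) (P₁ᵀ * P₁) := by
    rw [hsym]
    ext ((i | i) | i) ((j | j) | j) <;>
      simp [mul_apply, Fintype.sum_sum_type, two_mul]
  have hgram' : (incMat ℚ (plusEnd s x y) (plusEnd' t))ᵀ * incMat ℚ (plusEnd s x y) (plusEnd' t) =
      fromBlocks (fromBlocks (P₁ᵀ * P₁) (P₁ᵀ * P₂) (P₂ᵀ * P₁)
        (P₂ᵀ * P₂ + Xᵀ * X + Yᵀ * Y)) (fromRows 0 (-(X + Y)ᵀ))
        (fromCols 0 (-(X + Y))) ((2 : ℚ) • (1 : Matrix Φ Φ ℚ)) := by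
    rw [hplus]
    ext ((i | i) | i) ((j | j) | j) <;>
      simp [mul_apply, Fintype.sum_sum_type, one_apply, add_assoc, add_comm, eq_comm, ← two_mul]
  -- The parallelogram identity, which here is the series law: two unit edges in series act as one
  -- edge of weight `1/2`.
  have hpar : P₂ᵀ * P₂ + Xᵀ * X + Yᵀ * Y - (2⁻¹ : ℚ) • ((X + Y)ᵀ * (X + Y)) =
      P₂ᵀ * P₂ + (2⁻¹ : ℚ) • ((X - Y)ᵀ * (X - Y)) := by
    simp only [transpose_add, transpose_sub, Matrix.add_mul, Matrix.sub_mul, Matrix.mul_add,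
      Matrix.mul_sub]
    module
  rw [hgram, hgram', hminus, det_fromBlocks_reflect, det_fromBlocks_half, hpar]
  have comm (a b d d' m : ℚ) (h : d = d') : a * (b * d * m) = b * (a * d') * m := by
    subst h
    ring
  exact comm _ _ _ _ _ rfl

end Determinants

namespace Graph

/-! ### The reflection as a graph automorphism -/

section Mirror

variable {α β : Type*} {G : Graph α β}

namespace Drawing

variable {D : G.Drawing}

/-- A curve meets vertices only at its ends, so incidence can be read off from point sets, and the
reflection preserves it. -/
theorem inc_iff_pos_mem_trace {e : β} {v : α} (he : e ∈ E(G)) (hv : v ∈ V(G)) :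
    G.Inc e v ↔ D.pos v ∈ D.trace e := by
  obtain ⟨x, y, hxy, h0, h1⟩ := D.curve_ends e he
  constructor
  · intro h
    rcases h.eq_or_eq_of_isLink hxy with rfl | rfl
    exacts [⟨0, h0⟩, ⟨1, h1⟩]
  · rintro ⟨t, ht⟩
    by_cases ht0 : t = 0
    · subst ht0
      rw [D.pos_injOn hv hxy.left_mem (ht.symm.trans h0)]
      exact hxy.inc_left
    by_cases ht1 : t = 1
    · subst ht1
      rw [D.pos_injOn hv hxy.right_mem (ht.symm.trans h1)]
      exact hxy.inc_right
    exact absurd ht (D.curve_interior e he t ht0 ht1 v hv)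

theorem pos_mem_trace {e : β} {v : α} (h : G.Inc e v) : D.pos v ∈ D.trace e :=
  (inc_iff_pos_mem_trace h.edge_mem h.vertex_mem).1 h

theorem reflectPlane_eq_self_iff {p : ℝ × ℝ} : reflectPlane p = p ↔ p.1 = 0 := by
  simp [reflectPlane, Prod.ext_iff, neg_eq_self]

theorem reflectPlane_involutive : Function.Involutive reflectPlane := fun p => by
  simp [reflectPlane]

theorem mem_fixedVertices_iff {v : α} :
    v ∈ D.fixedVertices ↔ v ∈ V(G) ∧ (D.pos v).1 = 0 := by
  simp [fixedVertices, reflectPlane_eq_self_iff]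

theorem mem_fixedEdges_of_forall {e : β} (he : e ∈ E(G)) (h : ∀ p ∈ D.trace e, p.1 = 0) :
    e ∈ D.fixedEdges := by
  refine ⟨he, ?_⟩
  rw [Set.image_congr fun p hp => reflectPlane_eq_self_iff.2 (h p hp), Set.image_id']

theorem leftEdges_inter_rightEdges : Disjoint D.leftEdges D.rightEdges := by
  rw [Set.disjoint_left]
  rintro e ⟨he, hf, hl⟩ ⟨-, -, hr⟩
  exact hf (mem_fixedEdges_of_forall he fun p hp => le_antisymm (hl p hp) (hr p hp))

theorem IsReflective.mem_fixedVertices (hD : D.IsReflective) {e : β} {v : α}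
    (he : e ∈ D.fixedEdges) (h : G.Inc e v) : v ∈ D.fixedVertices :=
  ⟨h.vertex_mem, hD.fixed_pointwise e he _ (pos_mem_trace h)⟩

theorem IsReflective.mem_edgeSet_cases (hD : D.IsReflective) {e : β} (he : e ∈ E(G)) :
    e ∈ D.leftEdges ∨ e ∈ D.rightEdges ∨ e ∈ D.fixedEdges := by
  by_cases hf : e ∈ D.fixedEdges
  · exact .inr (.inr hf)
  · exact (hD.not_crossing e he).imp (⟨he, hf, ·⟩) fun h => .inl ⟨he, hf, h⟩

/-- The maps on vertices and edges that are induced by the reflection. -/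
structure Mirror (D : G.Drawing) where
  /-- the mirror image of a vertex -/
  vmap : α → α
  /-- the mirror image of an edge -/
  emap : β → β
  vmap_mem : ∀ v ∈ V(G), vmap v ∈ V(G)
  pos_vmap : ∀ v ∈ V(G), D.pos (vmap v) = reflectPlane (D.pos v)
  emap_mem : ∀ e ∈ E(G), emap e ∈ E(G)
  trace_emap : ∀ e ∈ E(G), D.trace (emap e) = reflectPlane '' D.trace e

theorem IsReflective.nonempty_mirror (hD : D.IsReflective) : Nonempty D.Mirror := by
  classical
  choose! f hf hf' using hD.vertex_reflect
  choose! g hg hg' using hD.edge_reflect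
  exact ⟨f, g, hf, hf', hg, hg'⟩

namespace Mirror

variable (m : D.Mirror)

theorem vmap_vmap {v : α} (hv : v ∈ V(G)) : m.vmap (m.vmap v) = v := by
  refine D.pos_injOn (m.vmap_mem _ (m.vmap_mem _ hv)) hv ?_
  rw [m.pos_vmap _ (m.vmap_mem _ hv), m.pos_vmap _ hv, reflectPlane_involutive]

theorem vmap_injOn : Set.InjOn m.vmap V(G) := fun v hv w hw h => by
  rw [← m.vmap_vmap hv, h, m.vmap_vmap hw]

theorem vmap_of_fixed {v : α} (hv : v ∈ D.fixedVertices) : m.vmap v = v :=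
  D.pos_injOn (m.vmap_mem _ hv.1) hv.1 ((m.pos_vmap _ hv.1).trans hv.2)

theorem emap_emap {e : β} (he : e ∈ E(G)) : m.emap (m.emap e) = e := by
  refine D.range_injOn (m.emap_mem _ (m.emap_mem _ he)) he ?_
  change D.trace _ = D.trace _
  rw [m.trace_emap _ (m.emap_mem _ he), m.trace_emap _ he, ← Set.image_comp,
    reflectPlane_involutive.comp_self, Set.image_id]

theorem emap_injOn : Set.InjOn m.emap E(G) := fun e he f hf h => by
  rw [← m.emap_emap he, h, m.emap_emap hf]

theorem inc_emap {e : β} {v : α} (h : G.Inc e v) : G.Inc (m.emap e) (m.vmap v) := by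
  rw [inc_iff_pos_mem_trace (D := D) (m.emap_mem _ h.edge_mem) (m.vmap_mem _ h.vertex_mem),
    m.pos_vmap _ h.vertex_mem, m.trace_emap _ h.edge_mem]
  exact Set.mem_image_of_mem _ (pos_mem_trace h)

theorem isLink_emap {e : β} {v w : α} (h : G.IsLink e v w) :
    G.IsLink (m.emap e) (m.vmap v) (m.vmap w) := by
  refine isLink_iff_inc.2 ⟨m.inc_emap h.inc_left, m.inc_emap h.inc_right, fun z hz => ?_⟩
  -- An end of the mirrored edge is reflected back to an end of the original one, so no further ends
  -- occur.
  have hz' := m.inc_emap hz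
  rw [m.emap_emap h.edge_mem] at hz'
  rcases hz'.eq_or_eq_of_isLink h with h' | h'
  · exact .inl (by rw [← h', m.vmap_vmap hz.vertex_mem])
  · exact .inr (by rw [← h', m.vmap_vmap hz.vertex_mem])

theorem emap_of_fixed {e : β} (he : e ∈ D.fixedEdges) : m.emap e = e :=
  D.range_injOn (m.emap_mem _ he.1) he.1 ((m.trace_emap _ he.1).trans he.2)

theorem emap_notMem_fixedEdges {e : β} (he : e ∈ E(G)) (h : e ∉ D.fixedEdges) :
    m.emap e ∉ D.fixedEdges := fun h' => h (by
  have := m.emap_of_fixed h'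
  rw [m.emap_emap he] at this
  rwa [this])

theorem emap_mem_rightEdges {e : β} (he : e ∈ D.leftEdges) : m.emap e ∈ D.rightEdges := by
  refine ⟨m.emap_mem _ he.1, m.emap_notMem_fixedEdges he.1 he.2.1, ?_⟩
  rw [m.trace_emap _ he.1]
  rintro _ ⟨p, hp, rfl⟩
  exact neg_nonneg.2 (he.2.2 p hp)

theorem emap_mem_leftEdges {e : β} (he : e ∈ D.rightEdges) : m.emap e ∈ D.leftEdges := by
  refine ⟨m.emap_mem _ he.1, m.emap_notMem_fixedEdges he.1 he.2.1, ?_⟩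
  rw [m.trace_emap _ he.1]
  rintro _ ⟨p, hp, rfl⟩
  exact neg_nonpos.2 (he.2.2 p hp)

end Mirror

theorem edgeSubgraph_isLink {F : Set β} {e : β} {x y : α} :
    (G.edgeSubgraph F).IsLink e x y ↔ e ∈ F ∧ G.IsLink e x y := Iff.rfl

theorem edgeSubgraph_inc {F : Set β} {e : β} {x : α} :
    (G.edgeSubgraph F).Inc e x ↔ e ∈ F ∧ G.Inc e x := by
  simp [Inc, edgeSubgraph_isLink]

/-- Walks in `G_+` are carried along by a map that respects the edges in `E_L` and `E^φ`. -/
theorem reflTransGen_of_plusGraph {γ : Type*} {R : γ → γ → Prop} {c : α → γ}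
    (hc : ∀ e ∈ D.leftEdges ∪ D.fixedEdges, ∀ x y, G.IsLink e x y → ReflTransGen R (c x) (c y))
    {u v : α} (h : ReflTransGen D.plusGraph.Adj (.inl u) (.inl v)) :
    ReflTransGen R (c u) (c v) := by
  -- At the midpoint of an edge the induction carries the claim for both ends of that edge, so
  -- either half may be taken next.
  have key : ∀ p, ReflTransGen D.plusGraph.Adj (.inl u) p →
      (∀ w, p = .inl w → ReflTransGen R (c u) (c w)) ∧
      ∀ e, p = .inr e → ∀ w, G.Inc e w → ReflTransGen R (c u) (c w) := by
    intro p hp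
    induction hp with
    | refl =>
      refine ⟨?_, by simp⟩
      rintro w hw
      rw [Sum.inl_injective hw]
    | tail _ hadj ih =>
      have half {e : β} {x : α} {a b : α ⊕ β} (ih : (∀ w, a = .inl w → ReflTransGen R (c u) (c w)) ∧
          ∀ e, a = .inr e → ∀ w, G.Inc e w → ReflTransGen R (c u) (c w))
          (hx : (G.edgeSubgraph (D.leftEdges ∪ D.fixedEdges)).Inc e x)
          (hab : (a = .inl x ∧ b = .inr e) ∨ (a = .inr e ∧ b = .inl x)) :
          (∀ w, b = .inl w → ReflTransGen R (c u) (c w)) ∧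
          ∀ e, b = .inr e → ∀ w, G.Inc e w → ReflTransGen R (c u) (c w) := by
        obtain ⟨he, y, hxy⟩ := edgeSubgraph_inc.1 hx
        rcases hab with ⟨rfl, rfl⟩ | ⟨rfl, rfl⟩
        · refine ⟨by simp, ?_⟩
          rintro e' h w hw
          obtain rfl := Sum.inr_injective h
          have hux := ih.1 x rfl
          rcases hw.eq_or_eq_of_isLink hxy with rfl | rfl
          exacts [hux, hux.trans (hc e he _ _ hxy)]
        · refine ⟨?_, by simp⟩
          rintro w hw
          obtain rfl := Sum.inl_injective hw
          exact ih.2 e rfl _ hxy.inc_left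
      obtain ⟨e | ⟨e, x, _ | _⟩, he⟩ := hadj
      · obtain ⟨-, x, y, ⟨he, hxy⟩, rfl, rfl⟩ := he
        refine ⟨?_, by simp⟩
        rintro w hw
        obtain rfl := Sum.inl_injective hw
        exact (ih.1 x rfl).trans (hc e he _ _ hxy)
      · exact half ih he.2.1 he.2.2
      · exact half ih he.2.1.inc he.2.2
  exact (key _ h).1 v rfl

end Drawing

end Mirror

/-! ### Presentations of `G`, `G_+` and `G_-` by common end maps -/

section Reflective

variable {α β : Type*} {G : Graph α β}

namespace Drawing

variable {D : G.Drawing}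

/-- The vertices to the left of the axis that are ends of left edges. -/
def leftVertices (D : G.Drawing) : Set α :=
  {v | (D.pos v).1 < 0 ∧ ∃ e ∈ D.leftEdges, G.Inc e v}

theorem leftVertices_subset : D.leftVertices ⊆ V(G) := fun _ ⟨_, _, _, h⟩ => h.vertex_mem

/-- The vertices of the left half, with a fixed vertex `r` as the root. -/
def halfVertex (D : G.Drawing) (r : α) :
    Option (D.leftVertices ⊕ ↥(D.fixedVertices \ {r})) → α :=
  fun a => a.elim r (Sum.elim (↑) (↑))

/-- The vertices on the axis, with a fixed vertex `r` as the root. -/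
def axisVertex (D : G.Drawing) (r : α) : Option ↥(D.fixedVertices \ {r}) → α :=
  fun a => a.elim r (↑)

theorem axisVertex_eq {r : α} (b : Option ↥(D.fixedVertices \ {r})) :
    D.axisVertex r b = D.halfVertex r (b.map Sum.inr) := by
  cases b <;> rfl

theorem exists_axisVertex_eq {r v : α} (hv : v ∈ D.fixedVertices) :
    ∃ b, D.axisVertex r b = v := by
  by_cases h : v = r
  · exact ⟨none, h.symm⟩
  · exact ⟨some ⟨v, hv, h⟩, rfl⟩

theorem exists_halfVertex_eq {e : β} (he : e ∈ D.leftEdges) {r v : α} (hv : G.Inc e v) :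
    ∃ a, D.halfVertex r a = v := by
  rcases (he.2.2 _ (pos_mem_trace hv)).lt_or_eq with h | h
  · exact ⟨some (.inl ⟨v, h, e, he, hv⟩), rfl⟩
  · obtain ⟨b, hb⟩ := exists_axisVertex_eq (r := r) (mem_fixedVertices_iff.2 ⟨hv.vertex_mem, h⟩)
    exact ⟨_, (axisVertex_eq b).symm.trans hb⟩

theorem pos_leftVertices (a : D.leftVertices) : (D.pos a).1 < 0 := a.2.1

theorem pos_fixedVertices {v : α} (hv : v ∈ D.fixedVertices) : (D.pos v).1 = 0 :=
  (mem_fixedVertices_iff.1 hv).2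

theorem halfVertex_injective {r : α} (hr : r ∈ D.fixedVertices) :
    (D.halfVertex r).Injective := by
  have hne (a : D.leftVertices) {v : α} (hv : v ∈ D.fixedVertices) : (a : α) ≠ v := fun h =>
    (pos_leftVertices a).ne (h ▸ pos_fixedVertices hv)
  rintro (_ | a | b) (_ | a' | b') h <;> simp only [halfVertex, Option.elim, Sum.elim_inl,
    Sum.elim_inr] at h
  · rfl
  · exact absurd h.symm (hne a' hr)
  · exact absurd h.symm b'.2.2
  · exact absurd h (hne a hr)
  · rw [Subtype.ext h]
  · exact absurd h (hne a b'.2.1)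
  · exact absurd h b.2.2
  · exact absurd h.symm (hne a' b.2.1)
  · rw [Subtype.ext h]

theorem exists_ends_left (D : G.Drawing) (r : α) :
    ∃ s t : D.leftEdges → Option (D.leftVertices ⊕ ↥(D.fixedVertices \ {r})),
      ∀ e : D.leftEdges, G.IsLink e (D.halfVertex r (s e)) (D.halfVertex r (t e)) := by
  have (e : D.leftEdges) : ∃ a b, G.IsLink e (D.halfVertex r a) (D.halfVertex r b) := by
    obtain ⟨x, y, h⟩ := exists_isLink_of_mem_edgeSet e.2.1
    obtain ⟨a, rfl⟩ := exists_halfVertex_eq (r := r) e.2 h.inc_left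
    obtain ⟨b, rfl⟩ := exists_halfVertex_eq (r := r) e.2 h.inc_right
    exact ⟨a, b, h⟩
  choose s t h using this
  exact ⟨s, t, h⟩

theorem IsReflective.exists_ends_fixed (hD : D.IsReflective) (r : α) :
    ∃ x y : D.fixedEdges → Option ↥(D.fixedVertices \ {r}),
      ∀ e : D.fixedEdges, G.IsLink e (D.axisVertex r (x e)) (D.axisVertex r (y e)) := by
  have (e : D.fixedEdges) : ∃ a b, G.IsLink e (D.axisVertex r a) (D.axisVertex r b) := by
    obtain ⟨x, y, h⟩ := exists_isLink_of_mem_edgeSet e.2.1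
    obtain ⟨a, rfl⟩ := exists_axisVertex_eq (r := r) (hD.mem_fixedVertices e.2 h.inc_left)
    obtain ⟨b, rfl⟩ := exists_axisVertex_eq (r := r) (hD.mem_fixedVertices e.2 h.inc_right)
    exact ⟨a, b, h⟩
  choose s t h using this
  exact ⟨s, t, h⟩

section Presentations

variable {r : α}
  {s t : D.leftEdges → Option (D.leftVertices ⊕ ↥(D.fixedVertices \ {r}))}
  {x y : D.fixedEdges → Option ↥(D.fixedVertices \ {r})}

/-- The vertices of the symmetric graph, in terms of those of its left half. -/
def Mirror.symVertex (m : D.Mirror) (r : α) :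
    Option ((D.leftVertices ⊕ ↥(D.fixedVertices \ {r})) ⊕ D.leftVertices) → α :=
  fun a => a.elim r (Sum.elim (Sum.elim (↑) (↑)) fun a => m.vmap a)

theorem Mirror.symVertex_leftCoord (m : D.Mirror) (a) :
    m.symVertex r (Option.map leftCoord a) = D.halfVertex r a := by
  rcases a with _ | _ | _ <;> rfl

theorem Mirror.symVertex_rightCoord (m : D.Mirror) (hr : r ∈ D.fixedVertices) (a) :
    m.symVertex r (Option.map rightCoord a) = m.vmap (D.halfVertex r a) := by
  rcases a with _ | _ | b
  exacts [(m.vmap_of_fixed hr).symm, rfl, (m.vmap_of_fixed b.2.1).symm]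

theorem Mirror.symVertex_axis (m : D.Mirror) (b) :
    m.symVertex r (Option.map (Sum.inl ∘ Sum.inr) b) = D.axisVertex r b := by
  cases b <;> rfl

/-- The sign of the first coordinate separates mirrored vertices from those on the left or on the
axis. -/
theorem Mirror.symVertex_injective (m : D.Mirror) (hr : r ∈ D.fixedVertices) :
    (m.symVertex r).Injective := by
  have hpos (a : D.leftVertices) : 0 < (D.pos (m.vmap a)).1 := by
    rw [m.pos_vmap _ (leftVertices_subset a.2)]
    exact neg_pos.2 (pos_leftVertices a)
  have hle (b) : (D.pos (D.halfVertex r b)).1 ≤ 0 := by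
    rcases b with _ | a | b
    exacts [(pos_fixedVertices hr).le, (pos_leftVertices a).le, (pos_fixedVertices b.2.1).le]
  have hne (a : D.leftVertices) (b) : m.vmap a ≠ D.halfVertex r b := fun h =>
    (hpos a).not_ge (h ▸ hle b)
  have hcases (a : Option ((D.leftVertices ⊕ ↥(D.fixedVertices \ {r})) ⊕ D.leftVertices)) :
      (∃ b, a = Option.map leftCoord b) ∨ ∃ b : D.leftVertices, a = some (.inr b) := by
    rcases a with _ | a | a
    exacts [.inl ⟨none, rfl⟩, .inl ⟨some a, rfl⟩, .inr ⟨a, rfl⟩]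
  intro a a' h
  rcases hcases a with ⟨b, rfl⟩ | ⟨b, rfl⟩ <;> rcases hcases a' with ⟨b', rfl⟩ | ⟨b', rfl⟩
  · rw [m.symVertex_leftCoord, m.symVertex_leftCoord] at h
    rw [halfVertex_injective hr h]
  · rw [m.symVertex_leftCoord] at h
    exact absurd h.symm (hne b' b)
  · rw [m.symVertex_leftCoord] at h
    exact absurd h (hne b b')
  · rw [Subtype.ext (m.vmap_injOn (leftVertices_subset b.2) (leftVertices_subset b'.2) h)]

/-- The edges of the symmetric graph. -/
def Mirror.symEdge (m : D.Mirror) : (D.leftEdges ⊕ D.leftEdges) ⊕ D.fixedEdges → β :=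
  Sum.elim (Sum.elim (fun e => e) fun e => m.emap e) fun e => e

theorem Mirror.presents (m : D.Mirror) (hD : D.IsReflective) (hr : r ∈ D.fixedVertices)
    (hst : ∀ e : D.leftEdges, G.IsLink e (D.halfVertex r (s e)) (D.halfVertex r (t e)))
    (hxy : ∀ e : D.fixedEdges, G.IsLink e (D.axisVertex r (x e)) (D.axisVertex r (y e))) :
    G.Presents (m.symVertex r) m.symEdge
      (symEnd s x) (symEnd t y) where
  vertex_injective := m.symVertex_injective hr
  edge_injective := by
    refine Function.Injective.sumElim (Function.Injective.sumElim Subtype.val_injective ?_ ?_)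
      Subtype.val_injective ?_
    · exact fun e f h => Subtype.ext (m.emap_injOn e.2.1 f.2.1 h)
    · exact fun e f h => Set.disjoint_left.1 leftEdges_inter_rightEdges e.2
        (h ▸ m.emap_mem_rightEdges f.2)
    · rintro (e | e) f h
      · refine e.2.2.1 ?_
        rw [show (e : β) = f from h]
        exact f.2
      · refine (m.emap_mem_rightEdges e.2).2.1 ?_
        rw [show m.emap e = f from h]
        exact f.2
  edgeSet_subset := fun e he => by
    rcases hD.mem_edgeSet_cases he with h | h | h
    · exact ⟨.inl (.inl ⟨e, h⟩), rfl⟩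
    · exact ⟨.inl (.inr ⟨_, m.emap_mem_leftEdges h⟩), m.emap_emap he⟩
    · exact ⟨.inr ⟨e, h⟩, rfl⟩
  isLink := by
    rintro ((e | e) | e)
    · simp only [symEnd, Sum.elim_inl, m.symVertex_leftCoord]
      exact hst e
    · simp only [symEnd, Sum.elim_inl, Sum.elim_inr, m.symVertex_rightCoord hr]
      exact m.isLink_emap (hst e)
    · simp only [symEnd, Sum.elim_inr, m.symVertex_axis]
      exact hxy e

/-- The vertices of `G_+`. -/
def plusVertex (D : G.Drawing) (r : α) :
    Option ((D.leftVertices ⊕ ↥(D.fixedVertices \ {r})) ⊕ D.fixedEdges) → α ⊕ β :=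
  fun a => a.elim (.inl r) (Sum.elim (fun a => .inl (D.halfVertex r (some a))) fun e => .inr e)

open Classical in
/-- The edges of `G_+`. -/
noncomputable def plusEdge (D : G.Drawing) (x y : D.fixedEdges → α) :
    D.leftEdges ⊕ (D.fixedEdges ⊕ D.fixedEdges) → β ⊕ (β × α × Bool) :=
  Sum.elim (fun e => .inl e) (Sum.elim (fun e => .inr (e, x e, false))
    fun e => .inr (e, y e, decide (x e = y e)))

theorem plusVertex_half (a) : D.plusVertex r (Option.map Sum.inl a) = .inl (D.halfVertex r a) := by
  cases a <;> rfl

theorem plusVertex_axis (b) :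
    D.plusVertex r (Option.map (Sum.inl ∘ Sum.inr) b) = .inl (D.axisVertex r b) := by
  cases b <;> rfl

theorem plusVertex_injective (hr : r ∈ D.fixedVertices) : (D.plusVertex r).Injective := by
  have hinj := halfVertex_injective hr
  rintro (_ | a | e) (_ | a' | e') h
  · rfl
  · cases hinj (a₁ := none) (a₂ := some a') (Sum.inl_injective h)
  · cases h
  · cases hinj (a₁ := some a) (a₂ := none) (Sum.inl_injective h)
  · cases hinj (a₁ := some a) (a₂ := some a') (Sum.inl_injective h)
    rfl
  · cases h
  · cases h
  · cases h
  · rw [Subtype.ext (Sum.inr_injective h)]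

theorem plusGraph_presents (hr : r ∈ D.fixedVertices)
    (hst : ∀ e : D.leftEdges, G.IsLink e (D.halfVertex r (s e)) (D.halfVertex r (t e)))
    (hxy : ∀ e : D.fixedEdges, G.IsLink e (D.axisVertex r (x e)) (D.axisVertex r (y e))) :
    D.plusGraph.Presents (D.plusVertex r)
      (D.plusEdge (fun e => D.axisVertex r (x e)) fun e => D.axisVertex r (y e))
      (plusEnd s x y) (plusEnd' t) where
  vertex_injective := plusVertex_injective hr
  edge_injective := by
    rintro (e | e | e) (f | f | f) h <;>
      simp only [plusEdge, Sum.elim_inl, Sum.elim_inr, Sum.inl.injEq, Sum.inr.injEq, Prod.mk.injEq,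
        reduceCtorEq] at h
    · rw [Subtype.ext h]
    · rw [Subtype.ext h.1]
    -- The two halves of one edge could only collide if its ends agree, but then the flag of the
    -- second half is `true`.
    · obtain ⟨h1, h2, h3⟩ := h
      obtain rfl := Subtype.ext h1
      simp [h2] at h3
    · obtain ⟨h1, h2, h3⟩ := h
      obtain rfl := Subtype.ext h1
      simp [h2] at h3
    · rw [Subtype.ext h.1]
  edgeSet_subset := fun e he => by
    obtain ⟨a, b, he⟩ := exists_isLink_of_mem_edgeSet he
    obtain e | ⟨e, v, _ | _⟩ := e
    · obtain ⟨hf, -, -, ⟨h | h, -⟩, -⟩ := he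
      · exact ⟨.inl ⟨e, h⟩, rfl⟩
      · exact absurd h hf
    · obtain ⟨hf, hv, -⟩ := he
      have hv' := (edgeSubgraph_inc.1 hv).2
      by_cases h : v = D.axisVertex r (x ⟨e, hf⟩)
      · exact ⟨.inr (.inl ⟨e, hf⟩), by simp [plusEdge, h]⟩
      · have h' := (hv'.eq_or_eq_of_isLink (hxy ⟨e, hf⟩)).resolve_left h
        refine ⟨.inr (.inr ⟨e, hf⟩), ?_⟩
        rw [h'] at h
        simp [plusEdge, h', Ne.symm h]
    · obtain ⟨hf, hv, -⟩ := he
      have hv' : G.IsLink e v v := hv.2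
      have h1 := hv'.isLink_iff.1 (hxy ⟨e, hf⟩)
      have hx : D.axisVertex r (x ⟨e, hf⟩) = v := by tauto
      have hy : D.axisVertex r (y ⟨e, hf⟩) = v := by tauto
      exact ⟨.inr (.inr ⟨e, hf⟩), by simp [plusEdge, hx, hy]⟩
  isLink := by
    rintro (e | e | e)
    · simp only [plusEnd, plusEnd', Sum.elim_inl, plusVertex_half]
      exact ⟨e.2.2.1, _, _, ⟨.inl e.2, hst e⟩, rfl, rfl⟩
    · simp only [plusEnd, plusEnd', Sum.elim_inl, Sum.elim_inr, plusVertex_axis]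
      exact ⟨e.2, edgeSubgraph_inc.2 ⟨.inr e.2, (hxy e).inc_left⟩, .inl ⟨rfl, rfl⟩⟩
    · simp only [plusEnd, plusEnd', Sum.elim_inr, plusVertex_axis]
      simp only [plusEdge, Sum.elim_inr]
      classical
      by_cases h : D.axisVertex r (x e) = D.axisVertex r (y e)
      · rw [decide_eq_true h]
        refine ⟨e.2, ?_, .inl ⟨rfl, rfl⟩⟩
        have := hxy e
        rw [h] at this
        exact ⟨.inr e.2, this⟩
      · rw [decide_eq_false h]
        exact ⟨e.2, edgeSubgraph_inc.2 ⟨.inr e.2, (hxy e).inc_right⟩, .inl ⟨rfl, rfl⟩⟩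

/-- The vertices of `G_-`. -/
def Mirror.minusVertex (m : D.Mirror) (a : Option D.leftVertices) : Option α :=
  a.map fun a : D.leftVertices => m.vmap a

theorem Mirror.vmap_leftVertices_notMem (m : D.Mirror) (a : D.leftVertices) :
    m.vmap a ∉ D.fixedVertices := fun h => by
  have h0 := pos_fixedVertices h
  rw [m.pos_vmap _ (leftVertices_subset a.2)] at h0
  exact (pos_leftVertices a).ne (neg_eq_zero.1 h0)

theorem Mirror.minusVertex_injective (m : D.Mirror) : m.minusVertex.Injective := by
  have : Function.Injective fun a : D.leftVertices => m.vmap a := fun a b h =>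
    Subtype.ext (m.vmap_injOn (leftVertices_subset a.2) (leftVertices_subset b.2) h)
  exact fun a b h => Option.map_injective this h

theorem Mirror.collapse_vmap (m : D.Mirror) (hr : r ∈ D.fixedVertices) (a) :
    collapse D.fixedVertices (m.vmap (D.halfVertex r a)) =
      m.minusVertex (a.bind (Sum.elim some fun _ => none)) := by
  rcases a with _ | a | b
  · change collapse _ (m.vmap r) = none
    rw [m.vmap_of_fixed hr, collapse, if_pos hr]
  · exact if_neg (m.vmap_leftVertices_notMem a)
  · change collapse _ (m.vmap b) = none
    rw [m.vmap_of_fixed b.2.1, collapse, if_pos b.2.1]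

/-- Right edges are indexed by their mirror images on the left, so that the end maps `s` and `t`
serve here too; the contracted axis is the root `none`. -/
theorem Mirror.minusGraph_presents (m : D.Mirror) (hr : r ∈ D.fixedVertices)
    (hst : ∀ e : D.leftEdges, G.IsLink e (D.halfVertex r (s e)) (D.halfVertex r (t e))) :
    D.minusGraph.Presents m.minusVertex (fun e : D.leftEdges => m.emap e)
      (minusEnd s) (minusEnd t) where
  vertex_injective := m.minusVertex_injective
  edge_injective := fun e f h => Subtype.ext (m.emap_injOn e.2.1 f.2.1 h)
  edgeSet_subset := fun e he => by
    obtain ⟨_, _, a, b, hab, -⟩ := exists_isLink_of_mem_edgeSet he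
    exact ⟨⟨_, m.emap_mem_leftEdges hab.1⟩, m.emap_emap hab.1.1⟩
  isLink := fun e => by
    have hs := m.collapse_vmap hr (s e)
    have ht := m.collapse_vmap hr (t e)
    exact ⟨_, _, ⟨m.emap_mem_rightEdges e.2, m.isLink_emap (hst e)⟩, hs, ht⟩

end Presentations

end Drawing

end Reflective

/-! ### Reachability of the root -/

section Reflective

variable {α β : Type*} {G : Graph α β}

namespace Drawing

variable {D : G.Drawing}

theorem inl_mem_plusGraph {e : β} {v : α} (he : e ∈ D.leftEdges ∪ D.fixedEdges)
    (hv : G.Inc e v) : (.inl v : α ⊕ β) ∈ V(D.plusGraph) :=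
  .inl ⟨v, ⟨e, he, hv⟩, rfl⟩

/-- A right edge at an axis vertex can be replaced by its mirror image. Hence every nonisolated axis
vertex belongs to `G_+`. -/
theorem Mirror.exists_inc_of_fixed (m : D.Mirror) (hD : D.IsReflective) {v : α}
    (hv : v ∈ D.fixedVertices) (h : ∃ e, G.Inc e v) :
    ∃ e ∈ D.leftEdges ∪ D.fixedEdges, G.Inc e v := by
  obtain ⟨e, he⟩ := h
  rcases hD.mem_edgeSet_cases he.edge_mem with h | h | h
  · exact ⟨e, .inl h, he⟩
  · refine ⟨_, .inl (m.emap_mem_leftEdges h), ?_⟩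
    have := m.inc_emap he
    rwa [m.vmap_of_fixed hv] at this
  · exact ⟨e, .inr h, he⟩

section Connectivity

variable {r : α} (m : D.Mirror) (hD : D.IsReflective) (hr : r ∈ D.fixedVertices)
  (hisolated : ∀ v ∈ D.fixedVertices, ∃ e, G.Inc e v) (hconn : D.plusGraph.IsConnected)

include m hD hr hisolated

theorem Mirror.halfVertex_mem_plusGraph (a) :
    (.inl (D.halfVertex r a) : α ⊕ β) ∈ V(D.plusGraph) := by
  have hfix {v : α} (hv : v ∈ D.fixedVertices) : (.inl v : α ⊕ β) ∈ V(D.plusGraph) := by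
    obtain ⟨e, he, hev⟩ := m.exists_inc_of_fixed hD hv (hisolated v hv)
    exact inl_mem_plusGraph he hev
  rcases a with _ | a | b
  · exact hfix hr
  · obtain ⟨-, e, he, hea⟩ := a.2
    exact inl_mem_plusGraph (.inl he) hea
  · exact hfix b.2.1

include hconn

theorem Mirror.plusVertex_reach (a) :
    ReflTransGen D.plusGraph.Adj (D.plusVertex r a) (D.plusVertex r none) := by
  refine hconn.2 _ ?_ _ (m.halfVertex_mem_plusGraph hD hr hisolated none)
  rcases a with _ | a | e
  · exact m.halfVertex_mem_plusGraph hD hr hisolated none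
  · exact m.halfVertex_mem_plusGraph hD hr hisolated (some a)
  · obtain ⟨x, y, hxy⟩ := exists_isLink_of_mem_edgeSet e.2.1
    exact .inr ⟨e, ⟨e.2, IsLink.edge_mem (x := x) (y := y) ⟨.inr e.2, hxy⟩⟩, rfl⟩

/-- Used with `c` the identity and the reflection to reach the root in `G`, and with the reflection
followed by collapsing the axis to reach it in `G_-`. -/
theorem Mirror.halfVertex_reach {γ : Type*} {R : γ → γ → Prop} {c : α → γ}
    (hc : ∀ e ∈ D.leftEdges ∪ D.fixedEdges, ∀ x y, G.IsLink e x y → ReflTransGen R (c x) (c y))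
    (a) : ReflTransGen R (c (D.halfVertex r a)) (c r) := by
  refine reflTransGen_of_plusGraph hc ?_
  have := m.plusVertex_reach hD hr hisolated hconn (a.map Sum.inl)
  rwa [plusVertex_half] at this

theorem Mirror.symVertex_reach (a) :
    ReflTransGen G.Adj (m.symVertex r a) (m.symVertex r none) := by
  have hleft := m.halfVertex_reach hD hr hisolated hconn (R := G.Adj) (c := id)
    fun e _ x y hxy => .single hxy.adj
  have hright := m.halfVertex_reach hD hr hisolated hconn (R := G.Adj) (c := m.vmap)
    fun e _ x y hxy => .single (m.isLink_emap hxy).adj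
  rcases a with _ | a | a
  · exact .refl
  · exact hleft (some a)
  · have := hright (some (.inl a))
    rwa [m.vmap_of_fixed hr] at this

theorem Mirror.minusVertex_reach (a) :
    ReflTransGen D.minusGraph.Adj (m.minusVertex a) (m.minusVertex none) := by
  have h := m.halfVertex_reach hD hr hisolated hconn (R := D.minusGraph.Adj)
    (c := fun v => collapse D.fixedVertices (m.vmap v)) (fun e he x y hxy => by
      rcases he with he | he
      · exact .single ⟨m.emap e, _, _, ⟨m.emap_mem_rightEdges he, m.isLink_emap hxy⟩, rfl, rfl⟩
      -- Both ends of an axis edge collapse to `none`, so the step becomes trivial.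
      · have hx := hD.mem_fixedVertices he hxy.inc_left
        have hy := hD.mem_fixedVertices he hxy.inc_right
        rw [m.vmap_of_fixed hx, m.vmap_of_fixed hy, collapse, collapse, if_pos hx, if_pos hy])
    (a.map Sum.inl)
  rw [m.collapse_vmap hr, m.vmap_of_fixed hr, collapse, if_pos hr] at h
  rcases a with _ | a
  exacts [.refl, h]

end Connectivity

end Drawing

end Reflective

end Graph

end SpanningForests

/-! ### Assembly -/

theorem mainTheorem2 {α β : Type*} (G : Graph α β)
    (hV : G.vertexSet.Finite) (hE : G.edgeSet.Finite)
    (D : G.Drawing) (hD : D.IsReflective)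
    (hfixed : D.fixedVertices.Nonempty)
    (hisolated : ∀ v ∈ D.fixedVertices, ∃ e, G.Inc e v)
    (hconn : D.plusGraph.IsConnected) :
    (G.numSpanningForests : ℚ) =
      (2 : ℚ) ^ ((D.fixedVertices.ncard : ℤ) - (D.fixedEdges.ncard : ℤ) - 1) *
        (D.plusGraph.numSpanningForests : ℚ) * (D.minusGraph.numSpanningForests : ℚ) := by
  classical
  obtain ⟨r, hr⟩ := hfixed
  obtain ⟨m⟩ := hD.nonempty_mirror
  obtain ⟨s, t, hst⟩ := D.exists_ends_left r
  obtain ⟨x, y, hxy⟩ := hD.exists_ends_fixed r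
  have hfin : D.fixedVertices.Finite := hV.subset fun v hv => hv.1
  have := (hV.subset D.leftVertices_subset).fintype
  have := (hfin.subset (Set.sdiff_subset (t := {r}))).fintype
  have := (hE.subset fun e (he : e ∈ D.leftEdges) => he.1).fintype
  have := (hE.subset fun e (he : e ∈ D.fixedEdges) => he.1).fintype
  have hG := (m.presents hD hr hst hxy).numSpanningForests_eq_det fun i =>
    m.symVertex_reach hD hr hisolated hconn (some i)
  have hplus := (Graph.Drawing.plusGraph_presents hr hst hxy).numSpanningForests_eq_det fun i =>
    m.plusVertex_reach hD hr hisolated hconn (some i)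
  have hminus := (m.minusGraph_presents hr hst).numSpanningForests_eq_det fun i =>
    m.minusVertex_reach hD hr hisolated hconn (some i)
  have hdet := det_symEnd s t x y
  rw [← hG, ← hplus, ← hminus] at hdet
  -- The deleted root lies on the axis; this is the `-1` in the exponent.
  have hB : D.fixedVertices.ncard = Fintype.card ↥(D.fixedVertices \ {r}) + 1 := by
    rw [← Nat.card_eq_fintype_card, Nat.card_coe_set_eq, Set.ncard_sdiff_singleton_add_one hr hfin]
  have hΦ : D.fixedEdges.ncard = Fintype.card D.fixedEdges := by
    rw [← Nat.card_eq_fintype_card, Nat.card_coe_set_eq]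
  rw [hB, hΦ, Nat.cast_add, Nat.cast_one, sub_right_comm, add_sub_cancel_right,
    zpow_sub₀ two_ne_zero, zpow_natCast, zpow_natCast]
  field_simp
  linarith
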